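/- Let $U=\{z\in\mathbb C:|z|<1\}$, $D_r=\{w\in\mathbb C:|w|<r\}$, and for $t\in(1/2,1)$ let $$G(t,z)=\frac1{1-2tz+z^2},\qquad z\in U.$$ For a function $F$ analytic on $D_r$, write $F\prec G(t,\cdot)$ on $D_r$ if there is an analytic function $\omega$ on $D_r$ with $\omega(0)=0$, $|\omega|<1$ and $F=G(t,\omega(\cdot))$ on $D_r$. Let $t\in(1/2,1)$, let $f(z)=z+\sum_{n\ge2}a_nz^n$ be analytic and univalent in $U$, let $r_0\ge 1/4$, and suppose that the inverse $g=f^{-1}$ (the analytic function near $0$ with $g(0)=0$ and $f(g(w))=w$) is defined, or continues analytically, as a univalent function on $D_{r_0}$. Suppose that $f$ belongs to the class $N_\Sigma(G,t)$, that is, $$\frac{f(z)}z\prec G(t,z)\ \text{ on } U\qquad\text{and}\qquad \frac{g(w)}w\prec G(t,w)\ \text{ on } D_{r_0},$$ where both quotients take the value $1$ at the origin. Then $$|a_2a_4-a_3^2|\le 8t^2 .$$ -/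

import Mathlib

open scoped Topology

noncomputable section

namespace BiUnivalent

/-- The open disk of radius `r` about the origin; `D 1` is the open unit disk `U`. -/
def D (r : ℝ) : Set ℂ := Metric.ball 0 r

/-- The `n`-th Taylor coefficient at the origin. -/
def coeff (f : ℂ → ℂ) (n : ℕ) : ℂ := iteratedDeriv n f 0 / (n.factorial : ℂ)

/-- The class `A`: functions analytic in the unit disk with `f z = z + a₂ z² + a₃ z³ + ⋯`. -/
def ClassA : Set (ℂ → ℂ) :=
  {f | AnalyticOnNhd ℂ f (D 1) ∧ f 0 = 0 ∧ deriv f 0 = 1}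

/-- The class `S` of univalent functions in `A`. -/
def ClassS : Set (ℂ → ℂ) := {f | f ∈ ClassA ∧ Set.InjOn f (D 1)}

/-- `g` is the inverse `f⁻¹` on the disk `D r`: it is analytic and univalent there, it fixes the
origin and inverts `f` near the origin. By the identity theorem this determines `g` on `D r`, and
`f (g w) = w` holds on all of `D r` as soon as `D r` is contained in the image of the unit disk.
For larger `r` the function `g` is the analytic continuation of `f⁻¹` to `D r`. -/
structure IsInverseOnDisk (f g : ℂ → ℂ) (r : ℝ) : Prop where
  analytic : AnalyticOnNhd ℂ g (D r)
  univalent : Set.InjOn g (D r)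
  map_zero : g 0 = 0
  right_inv : ∀ᶠ w in 𝓝 (0 : ℂ), f (g w) = w

/-- Subordination `F ≺ Φ` on the disk `D r`, by a Schwarz function `ω : D r → U`. -/
def SubordinateOn (r : ℝ) (F Φ : ℂ → ℂ) : Prop :=
  ∃ ω : ℂ → ℂ, AnalyticOnNhd ℂ ω (D r) ∧ ω 0 = 0 ∧ (∀ z ∈ D r, ‖ω z‖ < 1) ∧
    ∀ z ∈ D r, F z = Φ (ω z)

/-- `G(t, z) = 1 / (1 - 2 t z + z²)`, the generating function of the Chebyshev polynomials of the
second kind. Its denominator has no zero in the unit disk for `-1 < t < 1`. -/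
def G (t : ℝ) (z : ℂ) : ℂ := 1 / (1 - 2 * (t : ℂ) * z + z ^ 2)

/-- The function `(1 - β) f(z)/z + β f'(z)`. For `f 0 = 0`, `dslope f 0 z` is `f z / z` when
`z ≠ 0`, and at `z = 0` it is the value `f' 0` of the removable singularity. -/
def mean (β : ℝ) (f : ℂ → ℂ) (z : ℂ) : ℂ := (1 - (β : ℂ)) * dslope f 0 z + (β : ℂ) * deriv f z

/-- The class `Q_Σ(G, β, t)` of bi-univalent functions, where the inverse function `g = f⁻¹` is
considered on the disk `D r`. -/
def ClassQ (β t r : ℝ) : Set (ℂ → ℂ) :=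
  {f | f ∈ ClassS ∧ SubordinateOn 1 (mean β f) (G t) ∧
    ∃ g : ℂ → ℂ, IsInverseOnDisk f g r ∧ SubordinateOn r (mean β g) (G t)}

/-- The class `N_Σ(G, t)`, which is `Q_Σ(G, β, t)` for `β = 0`. -/
def ClassN (t r : ℝ) : Set (ℂ → ℂ) := ClassQ 0 t r

end BiUnivalent

end

namespace BiUnivalent

open Metric Filter

open scoped ComplexConjugate

/-! Write `f(z)/z = G(t, ω(z))` with a Schwarz function `ω = c₁z + c₂z² + c₃z³ + ⋯`. Comparing
coefficients in `(f(z)/z)(1 - 2tω + ω²) = 1` expresses `a₂, a₃, a₄` through the `cᵢ`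
(`coeff_of_dslope_eq`), and most terms of the determinant cancel: `a₂a₄ - a₃² = 4t²(c₁c₃ - c₂²) -
c₁⁴`. Cauchy's estimate gives `|c₃| ≤ 1`, and Schwarz–Pick for `ω(z)/z` gives `|c₂| ≤ 1 - |c₁|²`.
Since `4t² ≥ 1`, with `x = |c₁|` the modulus is at most `4t²(x + (1 - x²)² + x⁴) ≤ 8t²`.

Coefficients are read off by repeated division by `z` (`dslope` at `0`), so their comparison becomes
algebra with functions on the disk. -/

theorem coeff_eq_iterate_dslope {f : ℂ → ℂ} (hf : AnalyticAt ℂ f 0) (n : ℕ) :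
    coeff f n = (Function.swap dslope 0)^[n] f 0 := by
  have h := HasFPowerSeriesAt.has_fpower_series_iterate_dslope_fslope n hf.hasFPowerSeriesAt
  have h0 := h.coeff_zero 1
  rw [← h0]
  have := FormalMultilinearSeries.coeff_iterate_fslope
    (p := FormalMultilinearSeries.ofScalars ℂ (fun n ↦ iteratedDeriv n f 0 / (n.factorial : ℂ)))
    n 0
  rw [FormalMultilinearSeries.coeff, zero_add, FormalMultilinearSeries.coeff_ofScalars] at this
  rw [coeff, ← this]

theorem differentiableOn_dslope {f : ℂ → ℂ} (hf : DifferentiableOn ℂ f (ball 0 1)) :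
    DifferentiableOn ℂ (dslope f 0) (ball 0 1) :=
  (Complex.differentiableOn_dslope (ball_mem_nhds 0 one_pos)).2 hf

theorem eq_add_mul_dslope (f : ℂ → ℂ) (z : ℂ) : f z = f 0 + z * dslope f 0 z := by
  have := sub_smul_dslope f 0 z
  rw [sub_zero, smul_eq_mul] at this
  rw [this]; ring

/-- Cancellation of a factor `z`, including at the origin. -/
theorem eq_of_mul_eq {F H : ℂ → ℂ} (hF : ContinuousOn F (ball 0 1))
    (hH : ContinuousOn H (ball 0 1)) (h : ∀ z ∈ ball (0 : ℂ) 1, z * F z = z * H z) :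
    ∀ z ∈ ball (0 : ℂ) 1, F z = H z := by
  intro z hz
  by_cases hz0 : z = 0
  · subst hz0
    have hb : ball (0 : ℂ) 1 ∈ 𝓝 0 := ball_mem_nhds 0 one_pos
    have h1 : Tendsto F (𝓝[≠] 0) (𝓝 (F 0)) := (hF.continuousAt hb).tendsto.mono_left inf_le_left
    have h2 : Tendsto H (𝓝[≠] 0) (𝓝 (H 0)) := (hH.continuousAt hb).tendsto.mono_left inf_le_left
    refine tendsto_nhds_unique (h1.congr' ?_) h2
    filter_upwards [self_mem_nhdsWithin, mem_nhdsWithin_of_mem_nhds hb] with w hw hwb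
    exact mul_left_cancel₀ hw (h w hwb)
  · exact mul_left_cancel₀ hz0 (h z hz)

/-- The denominator in the Möbius transformation of the disk dominates the numerator. -/
theorem norm_sub_le_norm_one_sub_conj_mul {a w : ℂ} (ha : ‖a‖ ≤ 1) (hw : ‖w‖ ≤ 1) :
    ‖w - a‖ ≤ ‖1 - conj a * w‖ := by
  rw [← sq_le_sq₀ (norm_nonneg _) (norm_nonneg _), ← Complex.normSq_eq_norm_sq,
    ← Complex.normSq_eq_norm_sq]
  have h1 : Complex.normSq a ≤ 1 := by
    rw [Complex.normSq_eq_norm_sq]; exact pow_le_one₀ (norm_nonneg _) ha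
  have h2 : Complex.normSq w ≤ 1 := by
    rw [Complex.normSq_eq_norm_sq]; exact pow_le_one₀ (norm_nonneg _) hw
  -- `|1 - āw|² - |w - a|² = (1 - |a|²)(1 - |w|²)`.
  have := mul_nonneg (sub_nonneg.2 h1) (sub_nonneg.2 h2)
  simp only [Complex.normSq_apply, Complex.sub_re, Complex.sub_im, Complex.mul_re, Complex.mul_im,
    Complex.one_re, Complex.one_im, Complex.conj_re, Complex.conj_im] at this ⊢
  linarith

/-- The **Schwarz–Pick inequality** at the origin, when the value there lies in the open disk. -/
theorem norm_deriv_le_of_norm_lt_one {φ : ℂ → ℂ} (hφ : DifferentiableOn ℂ φ (ball 0 1))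
    (hb : ∀ z ∈ ball (0 : ℂ) 1, ‖φ z‖ ≤ 1) (h0 : ‖φ 0‖ < 1) :
    ‖deriv φ 0‖ ≤ 1 - ‖φ 0‖ ^ 2 := by
  set a := φ 0 with ha
  have hden : ∀ z ∈ ball (0 : ℂ) 1, 1 - conj a * φ z ≠ 0 := by
    intro z hz h
    have h1 : ‖conj a * φ z‖ = 1 := by rw [← sub_eq_zero.1 h, norm_one]
    rw [norm_mul, Complex.norm_conj] at h1
    nlinarith [hb z hz, norm_nonneg a, norm_nonneg (φ z)]
  have hmem : (0 : ℂ) ∈ ball (0 : ℂ) 1 := mem_ball_self one_pos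
  have hφ0 : HasDerivAt φ (deriv φ 0) 0 :=
    (hφ.differentiableAt (ball_mem_nhds 0 one_pos)).hasDerivAt
  have hd : HasDerivAt (fun z ↦ (φ z - a) / (1 - conj a * φ z))
      (deriv φ 0 / (1 - conj a * a)) 0 := by
    have hne := hden 0 hmem
    refine ((hφ0.sub_const a).div ((hφ0.const_mul (conj a)).const_sub 1) hne).congr_deriv ?_
    rw [← ha] at hne ⊢
    field_simp
    ring
  have key := Complex.norm_deriv_le_one_of_mapsTo_ball
    (f := fun z ↦ (φ z - a) / (1 - conj a * φ z)) (c := 0) (R := 1)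
    ((hφ.sub_const a).div ((hφ.const_mul (conj a)).const_sub 1) hden)
    (by
      intro z hz
      simp only [← ha, sub_self, zero_div, mem_closedBall_zero_iff, norm_div]
      exact div_le_one_of_le₀ (norm_sub_le_norm_one_sub_conj_mul h0.le (hb z hz)) (norm_nonneg _))
    one_pos
  have hpos : 0 < 1 - ‖a‖ ^ 2 := by nlinarith [norm_nonneg a]
  have hcast : (1 : ℂ) - conj a * a = ((1 - ‖a‖ ^ 2 : ℝ) : ℂ) := by
    rw [Complex.conj_mul']; push_cast; rfl
  rwa [hd.deriv, hcast, norm_div, Complex.norm_of_nonneg hpos.le, div_le_one hpos] at key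

/-- The **Schwarz–Pick inequality** at the origin. -/
theorem norm_deriv_le_one_sub_sq {φ : ℂ → ℂ} (hφ : DifferentiableOn ℂ φ (ball 0 1))
    (hb : ∀ z ∈ ball (0 : ℂ) 1, ‖φ z‖ ≤ 1) : ‖deriv φ 0‖ ≤ 1 - ‖φ 0‖ ^ 2 := by
  -- Scaling by `s < 1` moves the value at `0` into the open disk; then `s → 1`.
  have h : ∀ s ∈ Set.Ioo (0 : ℝ) 1, s * ‖deriv φ 0‖ ≤ 1 - (s * ‖φ 0‖) ^ 2 := by
    intro s hs
    have hn : ∀ z, ‖(s : ℂ) * φ z‖ = s * ‖φ z‖ := fun z ↦ by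
      rw [norm_mul, Complex.norm_of_nonneg hs.1.le]
    have hb0 := hb 0 (mem_ball_self one_pos)
    have := norm_deriv_le_of_norm_lt_one (hφ.const_mul (s : ℂ))
      (fun z hz ↦ by rw [hn]; nlinarith [hb z hz, hs.1, hs.2, norm_nonneg (φ z)])
      (by rw [hn]; nlinarith [hs.1, hs.2, norm_nonneg (φ 0)])
    rwa [hn, deriv_const_mul_field', norm_mul, Complex.norm_of_nonneg hs.1.le] at this
  have hl : Tendsto (fun s : ℝ ↦ s * ‖deriv φ 0‖) (𝓝[<] 1) (𝓝 (1 * ‖deriv φ 0‖)) :=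
    (Continuous.tendsto (by fun_prop) 1).mono_left inf_le_left
  have hr : Tendsto (fun s : ℝ ↦ 1 - (s * ‖φ 0‖) ^ 2) (𝓝[<] 1) (𝓝 (1 - (1 * ‖φ 0‖) ^ 2)) :=
    (Continuous.tendsto (by fun_prop) 1).mono_left inf_le_left
  have := le_of_tendsto_of_tendsto hl hr
    (by filter_upwards [Ioo_mem_nhdsLT one_pos] with s hs using h s hs)
  simpa using this

/-- Cauchy's estimate for the Taylor coefficients of a function bounded by one in the disk. -/
theorem norm_coeff_le_one {ω : ℂ → ℂ} (hω : DifferentiableOn ℂ ω (ball 0 1))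
    (hb : ∀ z ∈ ball (0 : ℂ) 1, ‖ω z‖ ≤ 1) (n : ℕ) : ‖coeff ω n‖ ≤ 1 := by
  have h : ∀ s ∈ Set.Ioo (0 : ℝ) 1, ‖coeff ω n‖ * s ^ n ≤ 1 := by
    intro s hs
    have hsub : closedBall (0 : ℂ) s ⊆ ball 0 1 := closedBall_subset_ball hs.2
    have := Complex.norm_iteratedDeriv_le_of_forall_mem_sphere_norm_le n hs.1
      ((hω.mono hsub).diffContOnCl_ball subset_rfl)
      (fun z hz ↦ hb z (hsub (sphere_subset_closedBall hz)))
    have hfac : (0 : ℝ) < n.factorial := by positivity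
    have hsn : 0 < s ^ n := pow_pos hs.1 n
    rw [coeff, norm_div, Complex.norm_natCast]
    rw [le_div_iff₀ hsn] at this
    rw [div_mul_eq_mul_div, div_le_one hfac]
    linarith
  have hl : Tendsto (fun s : ℝ ↦ ‖coeff ω n‖ * s ^ n) (𝓝[<] 1) (𝓝 (‖coeff ω n‖ * 1 ^ n)) :=
    (Continuous.tendsto (by fun_prop) 1).mono_left inf_le_left
  simpa using le_of_tendsto hl
    (by filter_upwards [Ioo_mem_nhdsLT one_pos] with s hs using h s hs)

/-- The roots are `t ± i√(1 - t²)`, both on the unit circle. -/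
theorem one_sub_mul_add_sq_ne_zero {t : ℝ} (ht : t ∈ Set.Ioo (-1 : ℝ) 1) {w : ℂ} (hw : ‖w‖ < 1) :
    1 - 2 * (t : ℂ) * w + w ^ 2 ≠ 0 := by
  intro h
  have hre := congrArg Complex.re h
  have him := congrArg Complex.im h
  simp [pow_two] at hre him
  have hw2 : w.re * w.re + w.im * w.im < 1 := by
    rw [← Complex.normSq_apply, Complex.normSq_eq_norm_sq]
    exact pow_lt_one₀ (norm_nonneg _) hw two_ne_zero
  have him' : w.im * (w.re - t) = 0 := by linarith
  rcases mul_eq_zero.1 him' with h0 | h0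
  · rw [h0] at hre
    nlinarith [sq_nonneg (w.re - t), ht.1, ht.2]
  · obtain rfl : w.re = t := by linarith
    nlinarith

/-- The Taylor coefficients of a function subordinate to `G t`, times `z`, in terms of those of the
Schwarz function. -/
theorem coeff_of_dslope_eq {t : ℝ} (ht : t ∈ Set.Ioo (-1 : ℝ) 1) {f ω : ℂ → ℂ}
    (hf : AnalyticOnNhd ℂ f (ball 0 1)) (hf1 : deriv f 0 = 1)
    (hω : AnalyticOnNhd ℂ ω (ball 0 1)) (hω0 : ω 0 = 0) (hb : ∀ z ∈ ball (0 : ℂ) 1, ‖ω z‖ < 1)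
    (h : ∀ z ∈ ball (0 : ℂ) 1, dslope f 0 z = G t (ω z)) :
    coeff f 2 = 2 * t * coeff ω 1 ∧
    coeff f 3 = 2 * t * coeff ω 2 + 2 * t * coeff f 2 * coeff ω 1 - coeff ω 1 ^ 2 ∧
    coeff f 4 = 2 * t * (coeff ω 3 + coeff f 2 * coeff ω 2 + coeff f 3 * coeff ω 1)
      - coeff f 2 * coeff ω 1 ^ 2 - 2 * coeff ω 1 * coeff ω 2 := by
  have hmem : (0 : ℂ) ∈ ball (0 : ℂ) 1 := mem_ball_self one_pos
  rw [coeff_eq_iterate_dslope (hf 0 hmem), coeff_eq_iterate_dslope (hf 0 hmem),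
    coeff_eq_iterate_dslope (hf 0 hmem), coeff_eq_iterate_dslope (hω 0 hmem),
    coeff_eq_iterate_dslope (hω 0 hmem), coeff_eq_iterate_dslope (hω 0 hmem)]
  simp only [Function.iterate_succ, Function.iterate_zero, Function.comp_apply, id_eq,
    Function.swap]
  have hF := differentiableOn_dslope hf.differentiableOn
  have hφ := differentiableOn_dslope hω.differentiableOn
  have eF := eq_add_mul_dslope (dslope f 0)
  have eφ := eq_add_mul_dslope (dslope ω 0)
  have eω := eq_add_mul_dslope ω
  rw [dslope_same, hf1] at eF
  rw [hω0] at eω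
  generalize dslope f 0 = F at *
  generalize dslope ω 0 = φ at *
  have hF1 := differentiableOn_dslope hF
  have eF1 := eq_add_mul_dslope (dslope F 0)
  have hψ := differentiableOn_dslope hφ
  have eψ := eq_add_mul_dslope (dslope φ 0)
  generalize dslope F 0 = F1 at *
  generalize dslope φ 0 = ψ at *
  have hF2 := differentiableOn_dslope hF1
  have eF2 := eq_add_mul_dslope (dslope F1 0)
  have hχ := differentiableOn_dslope hψ
  generalize dslope F1 0 = F2 at *
  generalize dslope ψ 0 = χ at *
  have hF3 := differentiableOn_dslope hF2
  generalize dslope F2 0 = F3 at *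
  replace hF1 := hF1.continuousOn
  replace hF2 := hF2.continuousOn
  replace hF3 := hF3.continuousOn
  replace hφ := hφ.continuousOn
  replace hψ := hψ.continuousOn
  replace hχ := hχ.continuousOn
  -- `s1`, `s2`, `s3` each remove one more factor `z` from the functional equation; their values at
  -- `0` are the three coefficient formulas.
  have s1 : ∀ z ∈ ball (0 : ℂ) 1,
      F1 z = (1 + z * F1 z) * (2 * t * φ z - z * φ z ^ 2) := by
    refine eq_of_mul_eq (by fun_prop) (by fun_prop) fun z hz ↦ ?_
    have := h z hz
    rw [G, eq_div_iff (one_sub_mul_add_sq_ne_zero ht (hb z hz)), eω z, eF z] at this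
    linear_combination this
  have r1 : F1 0 = 2 * t * φ 0 := by simpa using s1 0 hmem
  have s2 : ∀ z ∈ ball (0 : ℂ) 1,
      F2 z = 2 * t * ψ z + 2 * t * F1 z * φ z - (1 + z * F1 z) * φ z ^ 2 := by
    refine eq_of_mul_eq (by fun_prop) (by fun_prop) fun z hz ↦ ?_
    linear_combination s1 z hz - eF1 z - r1 + 2 * t * eφ z
  have r2 : F2 0 = 2 * t * ψ 0 + 2 * t * F1 0 * φ 0 - φ 0 ^ 2 := by simpa using s2 0 hmem
  have s3 : ∀ z ∈ ball (0 : ℂ) 1,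
      F3 z = 2 * t * χ z + 2 * t * (F1 0 * ψ z + F2 z * φ z)
        - F1 z * φ z ^ 2 - ψ z * (φ z + φ 0) := by
    refine eq_of_mul_eq (by fun_prop) (by fun_prop) fun z hz ↦ ?_
    linear_combination s2 z hz - eF2 z - r2 + 2 * t * eψ z + 2 * t * F1 0 * eφ z
      + 2 * t * φ z * eF1 z - (φ z + φ 0) * eφ z
  refine ⟨r1, r2, ?_⟩
  linear_combination s3 0 hmem

end BiUnivalent

open BiUnivalent in
theorem corollary2p1 (t : ℝ) (ht : t ∈ Set.Ioo (1 / 2 : ℝ) 1) (r₀ : ℝ) (hr₀ : 1 / 4 ≤ r₀)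
    (f : ℂ → ℂ) (hf : f ∈ BiUnivalent.ClassN t r₀) :
    ‖BiUnivalent.coeff f 2 * BiUnivalent.coeff f 4 - BiUnivalent.coeff f 3 ^ 2‖ ≤ 8 * t ^ 2 := by
  obtain ⟨⟨⟨hfa, -, hf1⟩, -⟩, ⟨ω, hω, hω0, hb, hsub⟩, -⟩ := hf
  rw [D] at hfa hω hb hsub
  have hmem : (0 : ℂ) ∈ Metric.ball (0 : ℂ) 1 := Metric.mem_ball_self one_pos
  obtain ⟨h2, h3, h4⟩ := coeff_of_dslope_eq ⟨by linarith [ht.1], ht.2⟩ hfa hf1 hω hω0 hb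
    (fun z hz ↦ by simpa [mean] using hsub z hz)
  have hc3 := norm_coeff_le_one hω.differentiableOn (fun z hz ↦ (hb z hz).le) 3
  have hc1 := norm_coeff_le_one hω.differentiableOn (fun z hz ↦ (hb z hz).le) 1
  have hc2 : ‖coeff ω 2‖ ≤ 1 - ‖coeff ω 1‖ ^ 2 := by
    rw [coeff_eq_iterate_dslope (hω 0 hmem), coeff_eq_iterate_dslope (hω 0 hmem)]
    simp only [Function.iterate_succ, Function.iterate_zero, Function.comp_apply, id_eq,
      Function.swap]
    -- `ω(z)/z` is bounded by one (Schwarz lemma), with value `c₁` and derivative `c₂` at `0`.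
    rw [dslope_same (dslope ω 0)]
    refine norm_deriv_le_one_sub_sq (differentiableOn_dslope hω.differentiableOn) fun z hz ↦ ?_
    refine (Complex.norm_dslope_le_div_of_mapsTo_ball (R₂ := 1) hω.differentiableOn
      (fun w hw ↦ ?_) hz).trans_eq (div_one 1)
    simpa [hω0] using (hb w hw).le
  generalize coeff ω 1 = c₁ at *
  generalize coeff ω 2 = c₂ at *
  generalize coeff ω 3 = c₃ at *
  have e : coeff f 2 * coeff f 4 - coeff f 3 ^ 2
      = ((4 * t ^ 2 : ℝ) : ℂ) * (c₁ * c₃ - c₂ ^ 2) - c₁ ^ 4 := by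
    rw [h4, h3, h2]; push_cast; ring
  have ht2 : 1 ≤ 4 * t ^ 2 := by nlinarith [ht.1]
  have hx := norm_nonneg c₁
  have hH : ‖c₁ * c₃ - c₂ ^ 2‖ ≤ ‖c₁‖ + (1 - ‖c₁‖ ^ 2) ^ 2 := by
    refine (norm_sub_le _ _).trans (add_le_add ?_ ?_)
    · rw [norm_mul]; exact mul_le_of_le_one_right hx hc3
    · rw [norm_pow]; exact pow_le_pow_left₀ (norm_nonneg _) hc2 2
  -- The gap is `(1 - x) + 2x²(1 - x)(1 + x)` with `x = |c₁|`.
  have hbound : ‖c₁‖ + (1 - ‖c₁‖ ^ 2) ^ 2 + ‖c₁‖ ^ 4 ≤ 2 := by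
    nlinarith [mul_nonneg (mul_nonneg hx hx) (sub_nonneg.2 hc1),
      mul_nonneg (mul_nonneg hx hx) (mul_nonneg hx (sub_nonneg.2 hc1))]
  rw [e]
  calc ‖((4 * t ^ 2 : ℝ) : ℂ) * (c₁ * c₃ - c₂ ^ 2) - c₁ ^ 4‖
      ≤ 4 * t ^ 2 * ‖c₁ * c₃ - c₂ ^ 2‖ + ‖c₁‖ ^ 4 := by
        refine (norm_sub_le _ _).trans_eq ?_
        rw [norm_mul, Complex.norm_of_nonneg (by linarith), norm_pow]
    _ ≤ 4 * t ^ 2 * (‖c₁‖ + (1 - ‖c₁‖ ^ 2) ^ 2) + 4 * t ^ 2 * ‖c₁‖ ^ 4 :=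
        add_le_add (mul_le_mul_of_nonneg_left hH (by linarith))
          (le_mul_of_one_le_left (by positivity) ht2)
    _ ≤ 8 * t ^ 2 := by nlinarith
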